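/- Let $\mathfrak H$ be a complex Hilbert space with inner product $(\cdot,\cdot)$, linear in the first argument, and let $J$ be a non-trivial fundamental symmetry, i.e. $J=J^*$, $J^2=I$, $J\neq\pm I$. Put $[f,g]=(Jf,g)$. Let $H$ be a $J$-symmetric operator in $\mathfrak H$, i.e. $[Hf,g]=[f,Hg]$ for all $f,g\in D(H)$, with eigenvectors $\{f_n\}_{n=1}^\infty$ corresponding to pairwise distinct, simple, real eigenvalues $\{\lambda_n\}_{n=1}^\infty$. Assume that the linear span of $\{f_n\}$ is dense in $\mathfrak H$ and that the eigenvectors are normalized so that $[f_n,f_n]^2=1$. Let $\mathfrak L_+^0$ (respectively $\mathfrak L_-^0$) be the closed linear span in $\mathfrak H$ of those $f_n$ with $[f_n,f_n]>0$ (respectively $[f_n,f_n]<0$); the sum $\mathcal D_0=\mathfrak L_+^0\dotplus\mathfrak L_-^0$ is direct and dense in $\mathfrak H$. Define $\mathcal C_0(u+v)=u-v$ for $u\in\mathfrak L_+^0$, $v\in\mathfrak L_-^0$, and $G_0=J\mathcal C_0$, a closed positive symmetric operator with domain $\mathcal D_0$. Let $G_F$ be the Friedrichs extension of $G_0$, i.e.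 the restriction of $G_0^*$ to $D[G_0]\cap D(G_0^*)$, where $D[G_0]\subset\mathfrak H$ is the closure of $D(G_0)$ with respect to the norm $\|f\|_0^2=\|f\|^2+(G_0f,f)$. An operator $\mathcal C$ in $\mathfrak H$ is called an operator of $\mathcal C$-symmetry if $\mathcal C^2f=f$ for all $f\in D(\mathcal C)$ (in particular $\mathcal C$ maps $D(\mathcal C)$ into itself) and $J\mathcal C$ is a positive self-adjoint operator in $\mathfrak H$, where positive means $(J\mathcal Cf,f)>0$ for all nonzero $f\in D(\mathcal C)$. For such $\mathcal C$ let $\mathfrak H_{\mathcal C}$ be the completion of $D(\mathcal C)$ with respect to the inner product $(f,g)_{\mathcal C}=[\mathcal Cf,g]$. If $\mathcal C$ is an operator of $\mathcal C$-symmetry and $\mathcal C=JG_F$, then all $f_n$ belong to $D(\mathcal C)$, and $\{f_n\}$ is an orthonormal basis of the Hilbert space $(\mathfrak H_{\mathcal C},(\cdot,\cdot)_{\mathcal C})$. -/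

import Mathlib

open Filter Topology

noncomputable section

namespace KreinC

variable {E : Type*} [NormedAddCommGroup E] [InnerProductSpace ℂ E]

/-- The indefinite inner product `[x, y] = (J x, y)`. It is linear in `x`: the inner product
`(x, y)`, linear in the first argument, is `inner ℂ y x` in Mathlib's convention. -/
def krein (J : E →L[ℂ] E) (x y : E) : ℂ :=
  inner ℂ y (J x)

/-- `J` is a non-trivial fundamental symmetry: `J = J*`, `J² = I`, `J ≠ I` and `J ≠ -I`. -/
structure IsFundamentalSymmetry [CompleteSpace E] (J : E →L[ℂ] E) : Prop where
  selfAdjoint : IsSelfAdjoint J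
  sq_eq_one : J * J = 1
  ne_one : J ≠ 1
  ne_neg_one : J ≠ -1

/-- `H` is `J`-symmetric: `[H x, y] = [x, H y]` for all `x, y ∈ D(H)`. -/
def IsJSymmetric (J : E →L[ℂ] E) (H : E →ₗ.[ℂ] E) : Prop :=
  ∀ x y : H.domain, krein J (H x) y = krein J x (H y)

/-- `(f n)` is a complete (i.e. total) sequence of eigenvectors of `H` that belong to the pairwise
distinct real eigenvalues `lam n`. -/
structure IsCompleteEigensystem (H : E →ₗ.[ℂ] E) (lam : ℕ → ℝ) (f : ℕ → E) : Prop where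
  mem_domain : ∀ n, f n ∈ H.domain
  ne_zero : ∀ n, f n ≠ 0
  eigen : ∀ n, H ⟨f n, mem_domain n⟩ = (lam n : ℂ) • f n
  distinct : Function.Injective lam
  /-- Each eigenvalue is simple. -/
  simple : ∀ n, ∀ x : H.domain, H x = (lam n : ℂ) • (x : E) → (x : E) ∈ Submodule.span ℂ {f n}
  /-- The linear span of the eigenvectors is dense. -/
  complete : Dense (Submodule.span ℂ (Set.range f) : Set E)

/-- `𝔏₊⁰`: the closed linear span of the `f n` with `[f n, f n] > 0`. -/
def posSpace (J : E →L[ℂ] E) (f : ℕ → E) : Submodule ℂ E :=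
  (Submodule.span ℂ (f '' {n | 0 < (krein J (f n) (f n)).re})).topologicalClosure

/-- `𝔏₋⁰`: the closed linear span of the `f n` with `[f n, f n] < 0`. -/
def negSpace (J : E →L[ℂ] E) (f : ℕ → E) : Submodule ℂ E :=
  (Submodule.span ℂ (f '' {n | (krein J (f n) (f n)).re < 0})).topologicalClosure

/-- The graph `{(u + v, u - v) : u ∈ L₊, v ∈ L₋}`. -/
def sumGraph (Lp Lm : Submodule ℂ E) : Submodule ℂ (E × E) :=
  Lp.map (LinearMap.prod LinearMap.id LinearMap.id) ⊔
    Lm.map (LinearMap.prod LinearMap.id (-LinearMap.id))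

/-- The operator `u + v ↦ u - v` (`u ∈ L₊`, `v ∈ L₋`) with domain `L₊ ∔ L₋`. It is meant for
subspaces with `L₊ ∩ L₋ = 0`, see `sumOp_apply`. -/
def sumOp (Lp Lm : Submodule ℂ E) : E →ₗ.[ℂ] E :=
  (sumGraph Lp Lm).toLinearPMap

theorem mem_sumGraph {Lp Lm : Submodule ℂ E} {p : E × E} :
    p ∈ sumGraph Lp Lm ↔ ∃ u ∈ Lp, ∃ v ∈ Lm, p = (u + v, u - v) := by
  simp only [sumGraph, Submodule.mem_sup, Submodule.mem_map]
  constructor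
  · rintro ⟨_, ⟨u, hu, rfl⟩, _, ⟨v, hv, rfl⟩, rfl⟩
    exact ⟨u, hu, v, hv, by ext <;> simp [sub_eq_add_neg]⟩
  · rintro ⟨u, hu, v, hv, rfl⟩
    exact ⟨_, ⟨u, hu, rfl⟩, _, ⟨v, hv, rfl⟩, by ext <;> simp [sub_eq_add_neg]⟩

theorem mem_sumOp_domain {Lp Lm : Submodule ℂ E} {x : E} :
    x ∈ (sumOp Lp Lm).domain ↔ ∃ u ∈ Lp, ∃ v ∈ Lm, x = u + v := by
  change x ∈ (sumGraph Lp Lm).map (LinearMap.fst ℂ E E) ↔ _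
  simp only [Submodule.mem_map, mem_sumGraph]
  constructor
  · rintro ⟨_, ⟨u, hu, v, hv, rfl⟩, rfl⟩
    exact ⟨u, hu, v, hv, rfl⟩
  · rintro ⟨u, hu, v, hv, rfl⟩
    exact ⟨_, ⟨u, hu, v, hv, rfl⟩, rfl⟩

theorem sumOp_apply {Lp Lm : Submodule ℂ E} (h : Disjoint Lp Lm) {u v : E} (hu : u ∈ Lp)
    (hv : v ∈ Lm) :
    sumOp Lp Lm ⟨u + v, mem_sumOp_domain.2 ⟨u, hu, v, hv, rfl⟩⟩ = u - v := by
  have key : ∀ x ∈ sumGraph Lp Lm, x.1 = 0 → x.2 = 0 := by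
    intro x hx h0
    obtain ⟨a, ha, b, hb, rfl⟩ := mem_sumGraph.1 hx
    have hab : a = -b := eq_neg_of_add_eq_zero_left h0
    have ha0 : a = 0 := Submodule.disjoint_def.1 h a ha (hab ▸ Lm.neg_mem hb)
    have hb0 : b = 0 := by simpa [ha0] using hab
    simp [ha0, hb0]
  have hg : (sumOp Lp Lm).graph = sumGraph Lp Lm := Submodule.toLinearPMap_graph_eq _ key
  have hm : (u + v, u - v) ∈ (sumOp Lp Lm).graph := by
    rw [hg]; exact mem_sumGraph.2 ⟨u, hu, v, hv, rfl⟩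
  obtain ⟨y, hy1, hy2⟩ := (LinearPMap.mem_graph_iff _).1 hm
  have : y = ⟨u + v, mem_sumOp_domain.2 ⟨u, hu, v, hv, rfl⟩⟩ := Subtype.ext hy1
  rw [← this]; exact hy2

/-- The operator `𝒞₀`, `u + v ↦ u - v`, on `𝔏₊⁰ ∔ 𝔏₋⁰`. -/
def C0 (J : E →L[ℂ] E) (f : ℕ → E) : E →ₗ.[ℂ] E :=
  sumOp (posSpace J f) (negSpace J f)

/-- The operator `G₀ = J 𝒞₀`. -/
def G0 (J : E →L[ℂ] E) (f : ℕ → E) : E →ₗ.[ℂ] E :=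
  (J : E →ₗ[ℂ] E).compPMap (C0 J f)

/-- The quadratic form `(G x, x)` of an operator `G`. -/
def form (G : E →ₗ.[ℂ] E) (x : G.domain) : ℝ :=
  (inner ℂ (x : E) (G x)).re

/-- `x ∈ D[G]`: the vector `x` is the limit in `E` of a sequence in `D(G)` that is Cauchy with
respect to the norm `‖u‖₀² = ‖u‖² + (G u, u)`. -/
def InFormClosure (G : E →ₗ.[ℂ] E) (x : E) : Prop :=
  ∃ u : ℕ → G.domain, Tendsto (fun n => (u n : E)) atTop (𝓝 x) ∧
    Tendsto (fun p : ℕ × ℕ => form G (u p.1 - u p.2)) atTop (𝓝 0)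

/-- The subspace `D[G]` of `E`. For an operator with nonnegative quadratic form the span may be
left out, see `mem_formDomain_iff`. -/
def formDomain (G : E →ₗ.[ℂ] E) : Submodule ℂ E :=
  Submodule.span ℂ {x | InFormClosure G x}

theorem mem_formDomain_iff {G : E →ₗ.[ℂ] E} (hG : ∀ x, 0 ≤ form G x) {x : E} :
    x ∈ formDomain G ↔ InFormClosure G x := by
  refine ⟨fun hx => ?_, fun hx => Submodule.subset_span hx⟩
  induction hx using Submodule.span_induction with
  | mem x hx => exact hx
  | zero => exact ⟨0, by simp, by simp [form]⟩
  | add x y _ _ hx hy =>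
    obtain ⟨u, hu, hu'⟩ := hx
    obtain ⟨v, hv, hv'⟩ := hy
    refine ⟨u + v, by simpa using hu.add hv, ?_⟩
    have hb : Tendsto (fun p : ℕ × ℕ => 2 * form G (u p.1 - u p.2) + 2 * form G (v p.1 - v p.2))
        atTop (𝓝 0) := by
      simpa using (hu'.const_mul 2).add (hv'.const_mul 2)
    refine squeeze_zero (fun _ => hG _) (fun p => ?_) hb
    have e : (u + v) p.1 - (u + v) p.2 = (u p.1 - u p.2) + (v p.1 - v p.2) := by
      simp only [Pi.add_apply]; abel
    have par : ∀ a b : G.domain,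
        form G (a + b) + form G (a - b) = 2 * form G a + 2 * form G b := by
      intro a b
      simp only [form, LinearPMap.map_add, LinearPMap.map_sub, Submodule.coe_add,
        Submodule.coe_sub, inner_add_left, inner_add_right, inner_sub_left, inner_sub_right,
        Complex.add_re, Complex.sub_re]
      ring
    rw [e]
    linarith [par (u p.1 - u p.2) (v p.1 - v p.2),
      hG ((u p.1 - u p.2) - (v p.1 - v p.2))]
  | smul c x _ hx =>
    obtain ⟨u, hu, hu'⟩ := hx
    refine ⟨fun n => c • u n, by simpa using hu.const_smul c, ?_⟩
    have hs : ∀ a : G.domain, form G (c • a) = ‖c‖ ^ 2 * form G a := by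
      intro a
      simp only [form, LinearPMap.map_smul, Submodule.coe_smul, inner_smul_left, inner_smul_right]
      rw [← mul_assoc, Complex.mul_conj', ← Complex.ofReal_pow, Complex.re_ofReal_mul]
    have : (fun p : ℕ × ℕ => form G (c • u p.1 - c • u p.2)) =
        fun p : ℕ × ℕ => ‖c‖ ^ 2 * form G (u p.1 - u p.2) := by
      funext p; rw [← smul_sub, hs]
    rw [this]
    simpa using hu'.const_mul (‖c‖ ^ 2)

/-- The Friedrichs extension `G_F`: the restriction of `G*` to `D[G] ∩ D(G*)`. -/
def friedrichs [CompleteSpace E] (G : E →ₗ.[ℂ] E) : E →ₗ.[ℂ] E :=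
  G.adjoint.domRestrict (formDomain G)

/-- `𝒞` is an operator of `𝒞`-symmetry in the Krein space given by `J`: `𝒞² x = x` for all
`x ∈ D(𝒞)`, and `J𝒞` is a positive self-adjoint operator. -/
structure IsCSymmetry [CompleteSpace E] (J : E →L[ℂ] E) (C : E →ₗ.[ℂ] E) : Prop where
  map_mem : ∀ x : C.domain, C x ∈ C.domain
  sq_apply : ∀ x : C.domain, C ⟨C x, map_mem x⟩ = x
  selfAdjoint : IsSelfAdjoint ((J : E →ₗ[ℂ] E).compPMap C)
  pos : ∀ x : C.domain, x ≠ 0 → 0 < (krein J (C x) x).re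

section Space

variable [CompleteSpace E] {J : E →L[ℂ] E} {C : E →ₗ.[ℂ] E}

theorem IsCSymmetry.symm (hC : IsCSymmetry J C) (x y : C.domain) :
    inner ℂ (J (C x)) (y : E) = inner ℂ (x : E) (J (C y)) := by
  have hd := hC.selfAdjoint.dense_domain
  have h := LinearPMap.adjoint_isFormalAdjoint hd
  rw [LinearPMap.isSelfAdjoint_def.1 hC.selfAdjoint] at h
  exact h x y

/-- The domain `D(𝒞)`, to be equipped with the inner product `(x, y)_𝒞 = [𝒞 x, y]`. -/
def PreHC (_hC : IsCSymmetry J C) : Type _ := C.domain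

instance (hC : IsCSymmetry J C) : AddCommGroup (PreHC hC) :=
  inferInstanceAs (AddCommGroup C.domain)

instance (hC : IsCSymmetry J C) : Module ℂ (PreHC hC) :=
  inferInstanceAs (Module ℂ C.domain)

/-- The inner product `(x, y)_𝒞 = [𝒞 x, y]` on `D(𝒞)`; in Mathlib's convention, where the second
argument is the linear one, `inner ℂ x y` is `(y, x)_𝒞`. -/
@[reducible] def innerCore (hC : IsCSymmetry J C) : InnerProductSpace.Core ℂ (PreHC hC) where
  inner x y := krein J (C (show C.domain from y)) (show C.domain from x)
  conj_inner_symm x y := by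
    change starRingEnd ℂ (inner ℂ _ (J (C _))) = inner ℂ _ (J (C _))
    rw [inner_conj_symm]
    exact hC.symm _ _
  re_inner_nonneg x := by
    by_cases h : (show C.domain from x) = 0
    · have hx : (x : PreHC hC) = 0 := h
      subst hx
      change 0 ≤ (krein J (C (0 : C.domain)) (0 : C.domain)).re
      simp [krein]
    · exact (hC.pos _ h).le
  add_left x y z := by
    change inner ℂ (((show C.domain from x) + (show C.domain from y) : C.domain) : E) _ = _
    rw [Submodule.coe_add, inner_add_left]; rfl
  smul_left x y r := by
    change inner ℂ ((r • (show C.domain from x) : C.domain) : E) _ = _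
    rw [Submodule.coe_smul, inner_smul_left]; rfl
  definite x h := by
    by_contra hx
    have := hC.pos x hx
    change krein J (C (show C.domain from x)) (show C.domain from x) = 0 at h
    exact absurd (congrArg Complex.re h) (ne_of_gt this)

instance (hC : IsCSymmetry J C) : NormedAddCommGroup (PreHC hC) :=
  (innerCore hC).toNormedAddCommGroup

instance (hC : IsCSymmetry J C) : InnerProductSpace ℂ (PreHC hC) :=
  InnerProductSpace.ofCore (innerCore hC).toCore

/-- The Hilbert space `ℌ_𝒞`: the completion of `D(𝒞)` with respect to `(·, ·)_𝒞`. -/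
abbrev HC (hC : IsCSymmetry J C) : Type _ := UniformSpace.Completion (PreHC hC)

/-- The canonical embedding of `D(𝒞)` into `ℌ_𝒞`. -/
def toHC (hC : IsCSymmetry J C) (x : C.domain) : HC hC :=
  ((show PreHC hC from x : PreHC hC) : UniformSpace.Completion (PreHC hC))

end Space

end KreinC

end

/-!
The sign operator `𝒞₀` and the operator `G₀ = J𝒞₀` make sense for every pair `𝔏₊`, `𝔏₋` of
`J`-orthogonal subspaces with dense sum; since `G₀ ⊆ G_F`, the hypothesis `𝒞 = JG_F` gives `𝒞₀ ⊆ 𝒞`.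
Hence `𝒞 f_n = [f_n, f_n] f_n`, and `(f_n, f_m)_𝒞 = [f_n, f_n] [f_n, f_m]` is the Kronecker delta.

For totality, `(x, y)_𝒞 = (x, J𝒞y)` shows that the embedding of `D(𝒞)`, with the norm of `ℌ`, into
`ℌ_𝒞` is closable. By the closed graph theorem it is continuous on every closed subspace contained
in `D(𝒞)`, so the closed span of the `f_n` in `ℌ_𝒞` contains the images of `𝔏₊⁰` and `𝔏₋⁰`, hence
that of `D(𝒞₀)`. Every vector of `D(𝒞)` lies in `D[G₀]`, so it is the limit in `ℌ` of a sequence in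
`D(𝒞₀)` that is Cauchy in `ℌ_𝒞`, and closability turns this into convergence in `ℌ_𝒞`.
-/

noncomputable section

namespace KreinC

variable {E : Type*} [NormedAddCommGroup E] [InnerProductSpace ℂ E] {J : E →L[ℂ] E}

theorem krein_eq_zero_of_mem_topologicalClosure_span {s t : Set E}
    (h : ∀ a ∈ s, ∀ b ∈ t, krein J a b = 0) {x y : E}
    (hx : x ∈ (Submodule.span ℂ s).topologicalClosure)
    (hy : y ∈ (Submodule.span ℂ t).topologicalClosure) : krein J x y = 0 := by
  have hspan : Submodule.span ℂ s ≤
      (Submodule.span ℂ t)ᗮ.comap (J : E →ₗ[ℂ] E) := Submodule.span_le.2 fun a ha => by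
    have hortho : Submodule.span ℂ {J a} ⟂ Submodule.span ℂ t :=
      Submodule.isOrtho_span.2 fun u hu b hb => by
        rw [Set.mem_singleton_iff.1 hu]
        exact inner_eq_zero_symm.1 (h a ha b hb)
    exact hortho (Submodule.mem_span_singleton_self _)
  have hclosed : IsClosed ((Submodule.span ℂ t)ᗮ.comap (J : E →ₗ[ℂ] E) : Set E) :=
    (Submodule.isClosed_orthogonal _).preimage J.continuous
  have hJx : J x ∈ (Submodule.span ℂ t)ᗮ := Submodule.topologicalClosure_minimal _ hspan hclosed hx
  rw [← Submodule.orthogonal_closure] at hJx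
  exact hJx y hy

section SumOp

variable {Lp Lm : Submodule ℂ E}

theorem sumOp_domain : (sumOp Lp Lm).domain = Lp ⊔ Lm := by
  ext x
  simp only [mem_sumOp_domain, Submodule.mem_sup, eq_comm]

theorem sumOp_apply_of_mem_left (h : Disjoint Lp Lm) {x : (sumOp Lp Lm).domain}
    (hx : (x : E) ∈ Lp) : sumOp Lp Lm x = x := by
  simpa only [add_zero, sub_zero] using sumOp_apply h hx (zero_mem Lm)

theorem sumOp_apply_of_mem_right (h : Disjoint Lp Lm) {x : (sumOp Lp Lm).domain}
    (hx : (x : E) ∈ Lm) : sumOp Lp Lm x = -x := by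
  simpa only [zero_add, zero_sub] using sumOp_apply h (zero_mem Lp) hx

theorem disjoint_of_krein_eq_zero (hJ : (J : E →ₗ[ℂ] E).IsSymmetric)
    (hinj : Function.Injective J) (horth : ∀ u ∈ Lp, ∀ v ∈ Lm, krein J u v = 0)
    (hdense : Dense ((Lp ⊔ Lm : Submodule ℂ E) : Set E)) : Disjoint Lp Lm := by
  refine Submodule.disjoint_def.2 fun x hxp hxm => (map_eq_zero_iff J hinj).1 ?_
  refine hdense.eq_zero_of_inner_left ℂ fun w hw => ?_
  obtain ⟨u, hu, v, hv, rfl⟩ := Submodule.mem_sup.1 hw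
  have hu0 : inner ℂ (J x) u = 0 := (hJ x u).trans (horth u hu x hxm)
  have hv0 : inner ℂ (J x) v = 0 := inner_eq_zero_symm.1 (horth x hxp v hv)
  rw [inner_add_right, hu0, hv0, add_zero]

theorem isFormalAdjoint_compPMap_sumOp (hJ : (J : E →ₗ[ℂ] E).IsSymmetric)
    (horth : ∀ u ∈ Lp, ∀ v ∈ Lm, krein J u v = 0) (hdisj : Disjoint Lp Lm) :
    ((J : E →ₗ[ℂ] E).compPMap (sumOp Lp Lm)).IsFormalAdjoint
      ((J : E →ₗ[ℂ] E).compPMap (sumOp Lp Lm)) := by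
  rintro ⟨x, hx⟩ ⟨y, hy⟩
  obtain ⟨u, hu, v, hv, rfl⟩ := mem_sumOp_domain.1 hx
  obtain ⟨a, ha, b, hb, rfl⟩ := mem_sumOp_domain.1 hy
  have hva : inner ℂ v (J a) = 0 := horth a ha v hv
  have hub : inner ℂ u (J b) = 0 := (hJ u b).symm.trans (inner_eq_zero_symm.1 (horth u hu b hb))
  calc inner ℂ (J (sumOp Lp Lm ⟨u + v, hx⟩)) (a + b)
      = inner ℂ (u - v) (J (a + b)) := by rw [sumOp_apply hdisj hu hv]; exact hJ _ _
    _ = inner ℂ (u + v) (J (a - b)) := by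
      simp only [map_add, map_sub, inner_add_left, inner_add_right, inner_sub_left,
        inner_sub_right, hva, hub]
      ring
    _ = inner ℂ (u + v) (J (sumOp Lp Lm ⟨a + b, hy⟩)) := by rw [sumOp_apply hdisj ha hb]

end SumOp

section Friedrichs

variable [CompleteSpace E]

theorem friedrichs_domain_le_formDomain (G : E →ₗ.[ℂ] E) :
    (friedrichs G).domain ≤ formDomain G :=
  inf_le_left

theorem le_friedrichs {G : E →ₗ.[ℂ] E} (hdense : Dense (G.domain : Set E))
    (hG : G.IsFormalAdjoint G) : G ≤ friedrichs G := by
  have hle : G ≤ G.adjoint := hG.le_adjoint hdense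
  have hform : G.domain ≤ formDomain G := fun x hx =>
    Submodule.subset_span ⟨fun _ => ⟨x, hx⟩, tendsto_const_nhds, by simp [form]⟩
  exact ⟨le_inf hform hle.1, fun x y hxy => hle.2 (y := ⟨y, y.2.2⟩) hxy⟩

theorem le_compPMap_friedrichs_compPMap (hJ : J * J = 1) {T : E →ₗ.[ℂ] E}
    (hdense : Dense (T.domain : Set E))
    (hT : ((J : E →ₗ[ℂ] E).compPMap T).IsFormalAdjoint ((J : E →ₗ[ℂ] E).compPMap T)) :
    T ≤ (J : E →ₗ[ℂ] E).compPMap (friedrichs ((J : E →ₗ[ℂ] E).compPMap T)) := by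
  have hle := le_friedrichs (G := (J : E →ₗ[ℂ] E).compPMap T) hdense hT
  refine ⟨hle.1, fun x y hxy => ?_⟩
  calc T x = J (J (T x)) := (DFunLike.congr_fun hJ (T x)).symm
    _ = J (friedrichs ((J : E →ₗ[ℂ] E).compPMap T) y) := congrArg J (hle.2 hxy)

end Friedrichs

section JOrthonormal

/-- `(f n)` is a `J`-orthonormal system: `[f n, f m] = 0` for `n ≠ m` and `[f n, f n] = ±1`. The
sign condition is encoded as in the normalization `[f n, f n] ^ 2 = 1`. -/
structure IsJOrthonormal {ι : Type*} (J : E →L[ℂ] E) (f : ι → E) : Prop where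
  orthogonal : Pairwise fun n m => krein J (f n) (f m) = 0
  sq_eq_one : ∀ n, krein J (f n) (f n) ^ 2 = 1

theorem pairwise_krein_eq_zero_of_eigenvectors {ι : Type*} {H : E →ₗ.[ℂ] E}
    (hH : IsJSymmetric J H) {lam : ι → ℝ} (hlam : Function.Injective lam) {f : ι → H.domain}
    (hf : ∀ n, H (f n) = (lam n : ℂ) • (f n : E)) :
    Pairwise fun n m => krein J (f n) (f m) = 0 := by
  intro n m hnm
  have hsymm : (lam n : ℂ) * krein J (f n) (f m) = lam m * krein J (f n) (f m) := by
    simpa only [krein, hf, map_smul, inner_smul_left, inner_smul_right, Complex.conj_ofReal]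
      using hH (f n) (f m)
  have hne : (lam n : ℂ) ≠ lam m := Complex.ofReal_injective.ne (hlam.ne hnm)
  exact (mul_eq_mul_right_iff.1 hsymm).resolve_left hne

theorem krein_eq_zero_of_mem_posSpace_of_mem_negSpace {f : ℕ → E}
    (hf : Pairwise fun n m => krein J (f n) (f m) = 0) {u v : E} (hu : u ∈ posSpace J f)
    (hv : v ∈ negSpace J f) : krein J u v = 0 := by
  refine krein_eq_zero_of_mem_topologicalClosure_span ?_ hu hv
  rintro _ ⟨n, hn, rfl⟩ _ ⟨m, hm, rfl⟩
  refine hf ?_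
  rintro rfl
  exact (show 0 < (krein J (f n) (f n)).re from hn).not_gt hm

variable {f : ℕ → E}

theorem IsJOrthonormal.krein_eq_one_and_mem_posSpace_or (hf : IsJOrthonormal J f) (n : ℕ) :
    krein J (f n) (f n) = 1 ∧ f n ∈ posSpace J f ∨
      krein J (f n) (f n) = -1 ∧ f n ∈ negSpace J f := by
  refine (sq_eq_one_iff.1 (hf.sq_eq_one n)).imp (fun h => ⟨h, ?_⟩) fun h => ⟨h, ?_⟩ <;>
    exact Submodule.le_topologicalClosure _ (Submodule.subset_span ⟨n, by simp [h], rfl⟩)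

theorem IsJOrthonormal.mem_C0_domain (hf : IsJOrthonormal J f) (n : ℕ) : f n ∈ (C0 J f).domain := by
  rw [C0, sumOp_domain]
  rcases hf.krein_eq_one_and_mem_posSpace_or n with ⟨-, h⟩ | ⟨-, h⟩
  exacts [Submodule.mem_sup_left h, Submodule.mem_sup_right h]

theorem IsJOrthonormal.dense_C0_domain (hf : IsJOrthonormal J f)
    (hdense : Dense (Submodule.span ℂ (Set.range f) : Set E)) : Dense ((C0 J f).domain : Set E) :=
  hdense.mono (Submodule.span_le.2 (Set.range_subset_iff.2 hf.mem_C0_domain))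

theorem IsJOrthonormal.disjoint_posSpace_negSpace (hf : IsJOrthonormal J f)
    (hJ : (J : E →ₗ[ℂ] E).IsSymmetric) (hinj : Function.Injective J)
    (hdense : Dense (Submodule.span ℂ (Set.range f) : Set E)) :
    Disjoint (posSpace J f) (negSpace J f) := by
  have hsup : Dense ((posSpace J f ⊔ negSpace J f : Submodule ℂ E) : Set E) := by
    rw [← sumOp_domain]
    exact hf.dense_C0_domain hdense
  exact disjoint_of_krein_eq_zero hJ hinj
    (fun _ hu _ hv => krein_eq_zero_of_mem_posSpace_of_mem_negSpace hf.orthogonal hu hv) hsup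

theorem IsJOrthonormal.C0_apply (hf : IsJOrthonormal J f)
    (hdisj : Disjoint (posSpace J f) (negSpace J f)) (n : ℕ) :
    C0 J f ⟨f n, hf.mem_C0_domain n⟩ = krein J (f n) (f n) • f n := by
  rcases hf.krein_eq_one_and_mem_posSpace_or n with ⟨hsign, h⟩ | ⟨hsign, h⟩
  · rw [hsign, one_smul]
    exact sumOp_apply_of_mem_left hdisj h
  · rw [hsign, neg_one_smul]
    exact sumOp_apply_of_mem_right hdisj h

theorem IsJOrthonormal.C0_le_compPMap_friedrichs [CompleteSpace E] (hf : IsJOrthonormal J f)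
    (hJ : (J : E →ₗ[ℂ] E).IsSymmetric) (hJJ : J * J = 1)
    (hdisj : Disjoint (posSpace J f) (negSpace J f))
    (hdense : Dense (Submodule.span ℂ (Set.range f) : Set E)) :
    C0 J f ≤ (J : E →ₗ[ℂ] E).compPMap (friedrichs (G0 J f)) :=
  le_compPMap_friedrichs_compPMap hJJ (hf.dense_C0_domain hdense)
    (isFormalAdjoint_compPMap_sumOp hJ
      (fun _ hu _ hv => krein_eq_zero_of_mem_posSpace_of_mem_negSpace hf.orthogonal hu hv) hdisj)

end JOrthonormal

namespace IsCSymmetry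

variable [CompleteSpace E] {C : E →ₗ.[ℂ] E} (hC : IsCSymmetry J C)

/-- The canonical embedding `toHC` of `D(𝒞)` into `ℌ_𝒞` as a linear map, through which linear
subspaces are transported between `ℌ` and `ℌ_𝒞`. -/
def toHCₗ : C.domain →ₗ[ℂ] HC hC where
  toFun := toHC hC
  map_add' x y := UniformSpace.Completion.coe_add (α := PreHC hC) x y
  map_smul' c x := UniformSpace.Completion.coe_smul (X := PreHC hC) c x

theorem inner_toHC (x y : C.domain) : inner ℂ (toHC hC x) (toHC hC y) = krein J (C y) x :=
  UniformSpace.Completion.inner_coe (E := PreHC hC) x y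

theorem denseRange_toHC : DenseRange (toHC hC) :=
  UniformSpace.Completion.denseRange_coe (α := PreHC hC)

theorem form_compPMap_eq_norm_toHC_sq {C₀ : E →ₗ.[ℂ] E} (hle : C₀ ≤ C) (x : C₀.domain) :
    form ((J : E →ₗ[ℂ] E).compPMap C₀) x = ‖toHC hC (Submodule.inclusion hle.1 x)‖ ^ 2 := by
  have hx : C₀ x = C (Submodule.inclusion hle.1 x) := hle.2 rfl
  calc form ((J : E →ₗ[ℂ] E).compPMap C₀) x
      = (krein J (C (Submodule.inclusion hle.1 x)) x).re := congrArg (fun z => (krein J z x).re) hx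
    _ = ‖toHC hC (Submodule.inclusion hle.1 x)‖ ^ 2 := by
      rw [← Submodule.coe_inclusion hle.1 x, ← inner_toHC]
      exact (norm_sq_eq_re_inner (𝕜 := ℂ) _).symm

theorem eq_toHC_of_tendsto {u : ℕ → C.domain} {x : C.domain} {z : HC hC}
    (hu : Tendsto (fun n => (u n : E)) atTop (𝓝 x))
    (hz : Tendsto (fun n => toHC hC (u n)) atTop (𝓝 z)) : z = toHC hC x := by
  refine (denseRange_toHC hC).eq_of_inner_left ℂ fun y => ?_
  have hlim : Tendsto (fun n => inner ℂ (toHC hC (u n)) (toHC hC y)) atTop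
      (𝓝 (inner ℂ (toHC hC x) (toHC hC y))) := by
    simp only [inner_toHC]
    exact hu.inner tendsto_const_nhds
  exact tendsto_nhds_unique (hz.inner tendsto_const_nhds) hlim

theorem continuous_toHC_inclusion {L : Submodule ℂ E} (hL : IsClosed (L : Set E))
    (hLC : L ≤ C.domain) : Continuous fun x : L => toHC hC (Submodule.inclusion hLC x) := by
  have : CompleteSpace L := hL.completeSpace_coe
  exact (toHCₗ hC ∘ₗ Submodule.inclusion hLC).continuous_of_seq_closed_graph fun u x z hu hz =>
    eq_toHC_of_tendsto hC (u := fun n => Submodule.inclusion hLC (u n))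
      ((continuous_subtype_val.tendsto x).comp hu) hz

theorem tendsto_toHC_of_tendsto_form {C₀ : E →ₗ.[ℂ] E} (hle : C₀ ≤ C) {u : ℕ → C₀.domain}
    {x : C.domain} (hu : Tendsto (fun n => (u n : E)) atTop (𝓝 x))
    (hform : Tendsto (fun p : ℕ × ℕ => form ((J : E →ₗ[ℂ] E).compPMap C₀) (u p.1 - u p.2))
      atTop (𝓝 0)) :
    Tendsto (fun n => toHC hC (Submodule.inclusion hle.1 (u n))) atTop (𝓝 (toHC hC x)) := by
  have hcauchy : CauchySeq fun n => toHC hC (Submodule.inclusion hle.1 (u n)) := by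
    rw [cauchySeq_iff_tendsto_dist_atTop_0, ← Real.sqrt_zero]
    refine hform.sqrt.congr fun p => ?_
    rw [form_compPMap_eq_norm_toHC_sq hC hle, Real.sqrt_sq (norm_nonneg _), dist_eq_norm]
    exact congrArg norm (map_sub (toHCₗ hC ∘ₗ Submodule.inclusion hle.1) (u p.1) (u p.2))
  obtain ⟨z, hz⟩ := cauchySeq_tendsto_of_complete hcauchy
  exact eq_toHC_of_tendsto hC hu hz ▸ hz

theorem denseRange_toHC_inclusion {C₀ : E →ₗ.[ℂ] E} (hle : C₀ ≤ C)
    (hform : C.domain ≤ formDomain ((J : E →ₗ[ℂ] E).compPMap C₀)) :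
    DenseRange fun x : C₀.domain => toHC hC (Submodule.inclusion hle.1 x) := by
  have hnonneg (x) : 0 ≤ form ((J : E →ₗ[ℂ] E).compPMap C₀) x :=
    (form_compPMap_eq_norm_toHC_sq hC hle x).symm ▸ sq_nonneg _
  refine dense_closure.1 ((denseRange_toHC hC).mono (Set.range_subset_iff.2 fun x => ?_))
  obtain ⟨u, hux, hu⟩ := (mem_formDomain_iff hnonneg).1 (hform x.2)
  exact mem_closure_of_tendsto (tendsto_toHC_of_tendsto_form hC hle hux hu)
    (Eventually.of_forall fun n => Set.mem_range_self (u n))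

/-- The subspace of those vectors of `D(𝒞)`, regarded as elements of `ℌ`, whose image in `ℌ_𝒞`
belongs to `K`. It lets closed spans in `ℌ` be compared with closed subspaces of `ℌ_𝒞`. -/
def toHCPreimage (K : Submodule ℂ (HC hC)) : Submodule ℂ E :=
  (K.comap (toHCₗ hC)).map C.domain.subtype

variable {K : Submodule ℂ (HC hC)}

theorem mem_toHCPreimage {x : C.domain} : (x : E) ∈ toHCPreimage hC K ↔ toHC hC x ∈ K :=
  C.domain.subtype_injective.mem_set_image

theorem topologicalClosure_le_toHCPreimage (hK : IsClosed (K : Set (HC hC))) {N : Submodule ℂ E}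
    (hNC : N.topologicalClosure ≤ C.domain) (hN : N ≤ toHCPreimage hC K) :
    N.topologicalClosure ≤ toHCPreimage hC K := fun x hx => by
  have hx' : (⟨x, hx⟩ : N.topologicalClosure) ∈ closure (Subtype.val ⁻¹' (N : Set E)) := by
    refine closure_subtype.2 (closure_mono (s := (N : Set E)) (fun y hy => ?_) hx)
    exact ⟨⟨y, N.le_topologicalClosure hy⟩, hy, rfl⟩
  have hmaps : Set.MapsTo (fun y : N.topologicalClosure => toHC hC (Submodule.inclusion hNC y))
      (Subtype.val ⁻¹' (N : Set E)) K := fun y hy => (mem_toHCPreimage hC).1 (hN hy)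
  have hmem := map_mem_closure
    (continuous_toHC_inclusion hC N.isClosed_topologicalClosure hNC) hx' hmaps
  exact (mem_toHCPreimage hC).2 (hK.closure_eq ▸ hmem)

theorem eq_top_of_domain_le_toHCPreimage {C₀ : E →ₗ.[ℂ] E} (hle : C₀ ≤ C)
    (hform : C.domain ≤ formDomain ((J : E →ₗ[ℂ] E).compPMap C₀))
    (hK : IsClosed (K : Set (HC hC))) (hC₀ : C₀.domain ≤ toHCPreimage hC K) : K = ⊤ := by
  have hrange : Set.range (fun x : C₀.domain => toHC hC (Submodule.inclusion hle.1 x)) ⊆ K :=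
    Set.range_subset_iff.2 fun x => (mem_toHCPreimage hC).1 (hC₀ x.2)
  exact SetLike.coe_injective
    (hK.closure_eq ▸ ((denseRange_toHC_inclusion hC hle hform).mono hrange).closure_eq)

variable {f : ℕ → E}

theorem topologicalClosure_span_toHC_eq_top (hle : C0 J f ≤ C)
    (hform : C.domain ≤ formDomain (G0 J f)) (hmem : ∀ n, f n ∈ C.domain) :
    (Submodule.span ℂ (Set.range fun n => toHC hC ⟨f n, hmem n⟩)).topologicalClosure = ⊤ := by
  set K := (Submodule.span ℂ (Set.range fun n => toHC hC ⟨f n, hmem n⟩)).topologicalClosure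
  have hK : IsClosed (K : Set (HC hC)) := Submodule.isClosed_topologicalClosure _
  have hspan (s : Set ℕ) : Submodule.span ℂ (f '' s) ≤ toHCPreimage hC K := by
    refine Submodule.span_le.2 (Set.image_subset_iff.2 fun n _ => ?_)
    exact (mem_toHCPreimage hC (x := ⟨f n, hmem n⟩)).2
      (Submodule.le_topologicalClosure _ (Submodule.subset_span ⟨n, rfl⟩))
  have hdom : posSpace J f ⊔ negSpace J f ≤ C.domain := sumOp_domain.ge.trans hle.1
  refine eq_top_of_domain_le_toHCPreimage hC hle hform hK (sumOp_domain.le.trans (sup_le ?_ ?_))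
  · exact topologicalClosure_le_toHCPreimage hC hK (le_sup_left.trans hdom) (hspan _)
  · exact topologicalClosure_le_toHCPreimage hC hK (le_sup_right.trans hdom) (hspan _)

theorem orthonormal_toHC (hf : IsJOrthonormal J f)
    (hdisj : Disjoint (posSpace J f) (negSpace J f)) (hle : C0 J f ≤ C)
    (hmem : ∀ n, f n ∈ C.domain) : Orthonormal ℂ fun n => toHC hC ⟨f n, hmem n⟩ := by
  have happly (n : ℕ) : C ⟨f n, hmem n⟩ = krein J (f n) (f n) • f n :=
    (hle.2 rfl).symm.trans (hf.C0_apply hdisj n)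
  have hinner (n m : ℕ) : inner ℂ (toHC hC ⟨f n, hmem n⟩) (toHC hC ⟨f m, hmem m⟩) =
      krein J (f m) (f m) * krein J (f m) (f n) := by
    rw [inner_toHC, happly]
    simp only [krein, map_smul, inner_smul_right]
  refine orthonormal_iff_ite.2 fun n m => ?_
  rw [hinner]
  split_ifs with hnm
  · rw [hnm, ← sq, hf.sq_eq_one]
  · rw [hf.orthogonal (Ne.symm hnm), mul_zero]

end IsCSymmetry

end KreinC

end

open KreinC in
theorem mainTheorem8_general {E : Type*} [NormedAddCommGroup E] [InnerProductSpace ℂ E]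
    [CompleteSpace E] (J : E →L[ℂ] E) (hJ : IsSelfAdjoint J) (hJJ : J * J = 1)
    (f : ℕ → E) (hf : IsJOrthonormal J f)
    (hdense : Dense (Submodule.span ℂ (Set.range f) : Set E))
    (C : E →ₗ.[ℂ] E) (hC : IsCSymmetry J C)
    (hCF : C = (J : E →ₗ[ℂ] E).compPMap (friedrichs (G0 J f))) :
    ∃ hmem : ∀ n, f n ∈ C.domain, ∃ b : HilbertBasis ℕ ℂ (HC hC),
      ∀ n, b n = toHC hC ⟨f n, hmem n⟩ := by
  have hinj : Function.Injective J :=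
    Function.LeftInverse.injective (g := J) fun x => DFunLike.congr_fun hJJ x
  have hdisj := hf.disjoint_posSpace_negSpace hJ.isSymmetric hinj hdense
  have hle : C0 J f ≤ C := hCF ▸ hf.C0_le_compPMap_friedrichs hJ.isSymmetric hJJ hdisj hdense
  have hform : C.domain ≤ formDomain (G0 J f) := hCF ▸ friedrichs_domain_le_formDomain (G0 J f)
  have hmem (n : ℕ) : f n ∈ C.domain := hle.1 (hf.mem_C0_domain n)
  exact ⟨hmem, HilbertBasis.mk (hC.orthonormal_toHC hf hdisj hle hmem)
    (hC.topologicalClosure_span_toHC_eq_top hle hform hmem).ge,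
    fun n => by rw [HilbertBasis.coe_mk]⟩

open KreinC in
theorem mainTheorem8 {E : Type*} [NormedAddCommGroup E] [InnerProductSpace ℂ E] [CompleteSpace E]
    (J : E →L[ℂ] E) (hJ : IsFundamentalSymmetry J)
    (H : E →ₗ.[ℂ] E) (hH : IsJSymmetric J H)
    (lam : ℕ → ℝ) (f : ℕ → E) (hf : IsCompleteEigensystem H lam f)
    (hnorm : ∀ n, krein J (f n) (f n) ^ 2 = 1)
    (C : E →ₗ.[ℂ] E) (hC : IsCSymmetry J C)
    (hCF : C = (J : E →ₗ[ℂ] E).compPMap (friedrichs (G0 J f))) :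
    ∃ hmem : ∀ n, f n ∈ C.domain, ∃ b : HilbertBasis ℕ ℂ (HC hC),
      ∀ n, b n = toHC hC ⟨f n, hmem n⟩ := by
  have horth := pairwise_krein_eq_zero_of_eigenvectors hH hf.distinct hf.eigen
  exact mainTheorem8_general J hJ.selfAdjoint hJ.sq_eq_one f ⟨horth, hnorm⟩ hf.complete C hC hCF
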